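/- Let $v:\mathbb{C}\to(0,\infty)$ be a weight, i.e. a continuous function which is radial ($v(z)=v(|z|)$ for all $z$), such that $v(r)$ is non-increasing on $[0,\infty)$ and $\lim_{r\to\infty} r^m v(r)=0$ for every $m\in\mathbb{N}$. Let $1\le p\le\infty$. For an entire function $f$ and $r>0$ put $M_p(f,r)=\big(\frac1{2\pi}\int_0^{2\pi}|f(re^{it})|^p\,dt\big)^{1/p}$ if $p<\infty$ and $M_\infty(f,r)=\sup_{|z|=r}|f(z)|$. Let $B_{p,0}=B_{p,0}(\mathbb{C},v)$ be the space of all entire functions $f$ with $\lim_{r\to\infty}v(r)M_p(f,r)=0$, endowed with the norm $\|f\|_{p,v}=\sup_{r>0}v(r)M_p(f,r)$. Suppose that $$\lim_{r\to\infty} v(r)\,\frac{e^r}{r^{1/(2p)}}=0$$ (where $1/(2p)=0$ if $p=\infty$), and that the differentiation operator $D:f\mapsto f'$ maps $B_{p,0}$ into itself and is continuous on $B_{p,0}$. Then there is a dense vector subspace $M$ of $B_{p,0}$ such that every nonzero $f\in M$ is distributionally irregular for $D:B_{p,0}\to B_{p,0}$; that is, there are strictly increasing sequences $(n_k)$ and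 $(m_k)$ of positive integers such that the sets $A=\{n_k\}$ and $B=\{m_k\}$ both have upper density $1$ (where the upper density of $A\subset\mathbb{N}$ is $\limsup_{n\to\infty}\frac1n\,\mathrm{card}(A\cap\{1,\dots,n\})$), $\lim_{k\to\infty}\|D^{n_k}f\|_{p,v}=0$ and $\lim_{k\to\infty}\|D^{m_k}f\|_{p,v}=\infty$. -/

import Mathlib

open Filter Topology MeasureTheory
open scoped ENNReal

noncomputable section

/-- The integral `p`-mean
`M_p(f, r) = ((1 / 2π) ∫₀^{2π} |f(r e^{it})|^p dt)^{1/p}` for `p < ∞`, and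
`M_∞(f, r) = sup_{|z| = r} |f z|`. -/
def integralMean (p : ℝ≥0∞) (f : ℂ → ℂ) (r : ℝ) : ℝ :=
  if p = ∞ then ⨆ z : Metric.sphere (0 : ℂ) r, ‖f z‖
  else ((1 / (2 * Real.pi)) * ∫ t in (0 : ℝ)..(2 * Real.pi),
    ‖f ((r : ℂ) * Complex.exp ((t : ℂ) * Complex.I))‖ ^ p.toReal) ^ (1 / p.toReal)

/-- A weight on `ℂ`: a strictly positive continuous radial function, non-increasing in `|z|`,
which decays faster than every power of `|z|`. -/
structure RadialWeight where
  /-- the underlying function -/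
  toFun : ℂ → ℝ
  pos : ∀ z, 0 < toFun z
  continuous : Continuous toFun
  radial : ∀ z : ℂ, toFun z = toFun ((‖z‖ : ℝ) : ℂ)
  antitone : AntitoneOn (fun r : ℝ => toFun (r : ℂ)) (Set.Ici 0)
  decay : ∀ m : ℕ, Tendsto (fun r : ℝ => r ^ m * toFun (r : ℂ)) atTop (𝓝 0)

instance : CoeFun RadialWeight (fun _ => ℂ → ℝ) := ⟨RadialWeight.toFun⟩

/-! ### Elementary facts on integral means -/

lemma integralMean_nonneg (p : ℝ≥0∞) (f : ℂ → ℂ) (r : ℝ) : 0 ≤ integralMean p f r := by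
  unfold integralMean
  split_ifs
  · exact Real.iSup_nonneg fun _ => norm_nonneg _
  · have : 0 ≤ ∫ t in (0 : ℝ)..(2 * Real.pi),
        ‖f ((r : ℂ) * Complex.exp ((t : ℂ) * Complex.I))‖ ^ p.toReal :=
      intervalIntegral.integral_nonneg (by positivity) fun t _ => by positivity
    positivity

lemma norm_mul_exp_I {r : ℝ} (hr : 0 ≤ r) (t : ℝ) :
    ‖(r : ℂ) * Complex.exp ((t : ℂ) * Complex.I)‖ = r := by
  rw [norm_mul, Complex.norm_exp_ofReal_mul_I, Complex.norm_real, mul_one, Real.norm_of_nonneg hr]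

/-- The normalized arc-length measure on the parameter interval. -/
def circleParamMeasure : Measure ℝ :=
  ENNReal.ofReal (1 / (2 * Real.pi)) • volume.restrict (Set.Ioc 0 (2 * Real.pi))

instance : IsFiniteMeasure circleParamMeasure := by
  unfold circleParamMeasure
  exact Measure.smul_finite _ ENNReal.ofReal_ne_top

lemma continuous_circle {f : ℂ → ℂ} (hf : Continuous f) (r : ℝ) :
    Continuous fun t : ℝ => f ((r : ℂ) * Complex.exp ((t : ℂ) * Complex.I)) := by
  fun_prop

lemma memLp_circle {f : ℂ → ℂ} (hf : Continuous f) (p : ℝ≥0∞) {r : ℝ} (hr : 0 ≤ r) :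
    MemLp (fun t : ℝ => f ((r : ℂ) * Complex.exp ((t : ℂ) * Complex.I))) p
      circleParamMeasure := by
  obtain ⟨C, hC⟩ := (isCompact_sphere (0 : ℂ) r).exists_bound_of_continuousOn hf.continuousOn
  refine MemLp.of_bound (continuous_circle hf r).aestronglyMeasurable C ?_
  exact Eventually.of_forall fun t => hC _ (by simp [abs_of_nonneg hr])

lemma integralMean_eq {f : ℂ → ℂ} (hf : Continuous f) {p : ℝ≥0∞} (hp0 : p ≠ 0) (hp : p ≠ ∞)
    {r : ℝ} (hr : 0 ≤ r) :
    integralMean p f r =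
      (eLpNorm (fun t : ℝ => f ((r : ℂ) * Complex.exp ((t : ℂ) * Complex.I))) p
        circleParamMeasure).toReal := by
  rw [(memLp_circle hf p hr).eLpNorm_eq_integral_rpow_norm hp0 hp, integralMean, if_neg hp,
    ENNReal.toReal_ofReal (by positivity), intervalIntegral.integral_of_le (by positivity),
    circleParamMeasure, integral_smul_measure, ENNReal.toReal_ofReal (by positivity), smul_eq_mul,
    one_div p.toReal]

lemma bddAbove_sphere {f : ℂ → ℂ} (hf : Continuous f) (r : ℝ) :
    BddAbove (Set.range fun z : Metric.sphere (0 : ℂ) r => ‖f z‖) := by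
  obtain ⟨C, hC⟩ := (isCompact_sphere (0 : ℂ) r).exists_bound_of_continuousOn hf.continuousOn
  exact ⟨C, by rintro _ ⟨z, rfl⟩; exact hC _ z.2⟩

lemma integralMean_add_le {f g : ℂ → ℂ} (hf : Continuous f) (hg : Continuous g) {p : ℝ≥0∞}
    (hp1 : 1 ≤ p) {r : ℝ} (hr : 0 ≤ r) :
    integralMean p (f + g) r ≤ integralMean p f r + integralMean p g r := by
  by_cases hp : p = ∞
  · simp only [integralMean, if_pos hp]
    have : Nonempty (Metric.sphere (0 : ℂ) r) :=
      (NormedSpace.sphere_nonempty.2 hr).to_subtype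
    refine ciSup_le fun z => (norm_add_le _ _).trans ?_
    exact add_le_add (le_ciSup (bddAbove_sphere hf r) z) (le_ciSup (bddAbove_sphere hg r) z)
  · have hp0 : p ≠ 0 := (zero_lt_one.trans_le hp1).ne'
    rw [integralMean_eq (hf.add hg) hp0 hp hr, integralMean_eq hf hp0 hp hr,
      integralMean_eq hg hp0 hp hr, ← ENNReal.toReal_add (memLp_circle hf p hr).eLpNorm_ne_top
        (memLp_circle hg p hr).eLpNorm_ne_top]
    refine ENNReal.toReal_mono (ENNReal.add_ne_top.2 ⟨(memLp_circle hf p hr).eLpNorm_ne_top,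
      (memLp_circle hg p hr).eLpNorm_ne_top⟩) ?_
    exact eLpNorm_add_le (memLp_circle hf p hr).1 (memLp_circle hg p hr).1 hp1

lemma integralMean_smul (c : ℂ) {f : ℂ → ℂ} (hf : Continuous f) {p : ℝ≥0∞}
    (hp1 : 1 ≤ p) {r : ℝ} (hr : 0 ≤ r) :
    integralMean p (c • f) r = ‖c‖ * integralMean p f r := by
  by_cases hp : p = ∞
  · simp only [integralMean, if_pos hp, Pi.smul_apply, norm_smul]
    rw [Real.mul_iSup_of_nonneg (norm_nonneg c)]
  · have hp0 : p ≠ 0 := (zero_lt_one.trans_le hp1).ne'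
    rw [integralMean_eq (hf.const_smul c) hp0 hp hr, integralMean_eq hf hp0 hp hr]
    have := eLpNorm_const_smul c
      (fun t : ℝ => f ((r : ℂ) * Complex.exp ((t : ℂ) * Complex.I))) p circleParamMeasure
    have h2 : (fun t : ℝ => (c • f) ((r : ℂ) * Complex.exp ((t : ℂ) * Complex.I))) =
      c • (fun t : ℝ => f ((r : ℂ) * Complex.exp ((t : ℂ) * Complex.I))) := rfl
    rw [h2, this, ENNReal.toReal_mul, toReal_enorm]

lemma integralMean_zero {p : ℝ≥0∞} (hp1 : 1 ≤ p) {r : ℝ} (hr : 0 ≤ r) :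
    integralMean p 0 r = 0 := by
  have := integralMean_smul 0 (f := 0) continuous_zero hp1 hr
  simpa using this

lemma integralMean_le_of_bound {f : ℂ → ℂ} {p : ℝ≥0∞} (hp1 : 1 ≤ p)
    {r : ℝ} (hr : 0 ≤ r) {C : ℝ} (hC : ∀ z : ℂ, ‖z‖ = r → ‖f z‖ ≤ C) :
    integralMean p f r ≤ C := by
  have hC0 : 0 ≤ C := (norm_nonneg _).trans (hC (r : ℂ) (by simp [abs_of_nonneg hr]))
  unfold integralMean
  split_ifs with hp
  · exact Real.iSup_le (fun z => hC z (by simp)) hC0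
  · have hp0 : 0 < p.toReal := ENNReal.toReal_pos (zero_lt_one.trans_le hp1).ne' hp
    have h1 : ‖∫ t in (0 : ℝ)..(2 * Real.pi),
        ‖f ((r : ℂ) * Complex.exp ((t : ℂ) * Complex.I))‖ ^ p.toReal‖ ≤
        C ^ p.toReal * |2 * Real.pi - 0| := by
      refine intervalIntegral.norm_integral_le_of_norm_le_const fun t _ => ?_
      rw [Real.norm_of_nonneg (by positivity)]
      exact Real.rpow_le_rpow (norm_nonneg _) (hC _ (norm_mul_exp_I hr t)) hp0.le
    have h0 : 0 ≤ ∫ t in (0 : ℝ)..(2 * Real.pi),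
        ‖f ((r : ℂ) * Complex.exp ((t : ℂ) * Complex.I))‖ ^ p.toReal :=
      intervalIntegral.integral_nonneg (by positivity) fun t _ => by positivity
    rw [Real.norm_of_nonneg h0, sub_zero, abs_of_pos (by positivity)] at h1
    have h2 : (1 / (2 * Real.pi)) * ∫ t in (0 : ℝ)..(2 * Real.pi),
        ‖f ((r : ℂ) * Complex.exp ((t : ℂ) * Complex.I))‖ ^ p.toReal ≤ C ^ p.toReal := by
      rw [one_div, inv_mul_le_iff₀ (by positivity)]
      linarith [h1]
    calc _ ≤ (C ^ p.toReal) ^ (1 / p.toReal) :=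
          Real.rpow_le_rpow (by positivity) h2 (by positivity)
      _ = C := by rw [one_div, Real.rpow_rpow_inv hC0 hp0.ne']

lemma eq_zero_of_integralMean_eq_zero {f : ℂ → ℂ} (hf : Continuous f) {p : ℝ≥0∞} (hp1 : 1 ≤ p)
    {r : ℝ} (h : integralMean p f r = 0) {z : ℂ} (hz : ‖z‖ = r) : f z = 0 := by
  by_cases hp : p = ∞
  · rw [integralMean, if_pos hp] at h
    have := le_ciSup (bddAbove_sphere hf r) (⟨z, by simpa using hz⟩ : Metric.sphere (0 : ℂ) r)
    rw [h] at this
    exact norm_le_zero_iff.1 this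
  · have hp0 : p ≠ 0 := (zero_lt_one.trans_le hp1).ne'
    have hpr : 0 < p.toReal := ENNReal.toReal_pos hp0 hp
    set F : ℝ → ℝ := fun t => ‖f ((r : ℂ) * Complex.exp ((t : ℂ) * Complex.I))‖ ^ p.toReal with hF
    have hFc : Continuous F := by
      have := (continuous_circle hf r).norm
      exact this.rpow_const fun _ => Or.inr hpr.le
    obtain ⟨s, hs, hzs⟩ : ∃ s ∈ Set.Icc (0 : ℝ) (2 * Real.pi),
        (r : ℂ) * Complex.exp ((s : ℂ) * Complex.I) = z := by
      have h1 : (r : ℂ) * Complex.exp ((Complex.arg z : ℂ) * Complex.I) = z := by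
        rw [← hz]; exact Complex.norm_mul_exp_arg_mul_I z
      rcases le_or_gt 0 (Complex.arg z) with h0 | h0
      · exact ⟨_, ⟨h0, by linarith [Complex.arg_le_pi z, Real.pi_pos]⟩, h1⟩
      · refine ⟨Complex.arg z + 2 * Real.pi,
          ⟨by linarith [Complex.neg_pi_lt_arg z, Real.pi_pos], by linarith⟩, ?_⟩
        push_cast
        rw [add_mul, Complex.exp_add, Complex.exp_two_pi_mul_I, mul_one, h1]
    by_contra hne
    have hpos : 0 < ∫ t in (0 : ℝ)..(2 * Real.pi), F t := by
      refine intervalIntegral.integral_pos (by positivity) hFc.continuousOn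
        (fun t _ => by positivity) ⟨s, hs, ?_⟩
      have : 0 < ‖f z‖ := norm_pos_iff.2 hne
      simp only [hF, hzs]
      positivity
    rw [integralMean, if_neg hp] at h
    have : 0 < ((1 / (2 * Real.pi)) * ∫ t in (0 : ℝ)..(2 * Real.pi), F t) ^ (1 / p.toReal) := by
      positivity
    exact this.ne' h

/-! ### The weighted space `B_{p,0}` -/

/-- The vector space of entire functions `f` with `v(r) M_p(f, r) → 0` as `r → ∞`. -/
def weightedSubmodule (v : RadialWeight) (p : ℝ≥0∞) [hp : Fact (1 ≤ p)] :
    Submodule ℂ (ℂ → ℂ) where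
  carrier := {f | Differentiable ℂ f ∧
    Tendsto (fun r : ℝ => v (r : ℂ) * integralMean p f r) atTop (𝓝 0)}
  zero_mem' := by
    refine ⟨differentiable_const 0, ?_⟩
    refine tendsto_const_nhds.congr' ?_
    filter_upwards [eventually_ge_atTop 0] with r hr
    rw [integralMean_zero hp.1 hr, mul_zero]
  add_mem' := by
    rintro f g ⟨hf, hf0⟩ ⟨hg, hg0⟩
    refine ⟨hf.add hg, ?_⟩
    have := hf0.add hg0
    rw [add_zero] at this
    refine tendsto_of_tendsto_of_tendsto_of_le_of_le' tendsto_const_nhds this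
      (Eventually.of_forall fun r => mul_nonneg (v.pos _).le (integralMean_nonneg _ _ _)) ?_
    filter_upwards [eventually_ge_atTop 0] with r hr
    rw [← mul_add]
    exact mul_le_mul_of_nonneg_left
      (integralMean_add_le hf.continuous hg.continuous hp.1 hr) (v.pos _).le
  smul_mem' := by
    rintro c f ⟨hf, hf0⟩
    refine ⟨hf.const_smul c, ?_⟩
    have := hf0.const_mul ‖c‖
    rw [mul_zero] at this
    refine this.congr' ?_
    filter_upwards [eventually_ge_atTop 0] with r hr
    rw [integralMean_smul c hf.continuous hp.1 hr]
    ring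

/-- The weighted space `B_{p,0}(ℂ, v)` of entire functions, with the norm
`‖f‖ = sup_{r > 0} v(r) M_p(f, r)` (a type of its own, so that it carries the topology of this
norm and not that of pointwise convergence). -/
def WeightedB0 (v : RadialWeight) (p : ℝ≥0∞) [Fact (1 ≤ p)] : Type :=
  weightedSubmodule v p

namespace WeightedB0

variable {v : RadialWeight} {p : ℝ≥0∞} [hp : Fact (1 ≤ p)]

instance : AddCommGroup (WeightedB0 v p) :=
  inferInstanceAs (AddCommGroup (weightedSubmodule v p))

instance : Module ℂ (WeightedB0 v p) :=
  inferInstanceAs (Module ℂ (weightedSubmodule v p))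

instance : CoeFun (WeightedB0 v p) (fun _ => ℂ → ℂ) := ⟨fun f => f.1⟩

instance : Norm (WeightedB0 v p) :=
  ⟨fun f => ⨆ r : Set.Ioi (0 : ℝ), v ((r : ℝ) : ℂ) * integralMean p f (r : ℝ)⟩

lemma norm_def (f : WeightedB0 v p) :
    ‖f‖ = ⨆ r : Set.Ioi (0 : ℝ), v ((r : ℝ) : ℂ) * integralMean p f (r : ℝ) := rfl

lemma differentiable (f : WeightedB0 v p) : Differentiable ℂ (f : ℂ → ℂ) := f.2.1

lemma bddAbove (f : WeightedB0 v p) :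
    BddAbove (Set.range fun r : Set.Ioi (0 : ℝ) =>
      v ((r : ℝ) : ℂ) * integralMean p f (r : ℝ)) := by
  obtain ⟨R, hR⟩ := eventually_atTop.1 (f.2.2.eventually (gt_mem_nhds zero_lt_one))
  obtain ⟨C, hC⟩ := (isCompact_closedBall (0 : ℂ) R).exists_bound_of_continuousOn
    f.differentiable.continuous.continuousOn
  refine ⟨max 1 (v 0 * C), ?_⟩
  rintro _ ⟨⟨r, hr⟩, rfl⟩
  have hr0 : (0 : ℝ) ≤ r := le_of_lt hr
  rcases le_total R r with h | h
  · exact le_max_of_le_left (hR r h).le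
  · refine le_max_of_le_right ?_
    have h1 : integralMean p f r ≤ C :=
      integralMean_le_of_bound hp.1 hr0 fun z hz => hC z (by simpa [hz] using h)
    have h2 : v (r : ℂ) ≤ v 0 := by
      simpa using v.antitone (Set.self_mem_Ici) hr0 hr0
    exact mul_le_mul h2 h1 (integralMean_nonneg _ _ _) (v.pos _).le

lemma core : NormedSpace.Core ℂ (WeightedB0 v p) where
  norm_nonneg f := Real.iSup_nonneg fun _ => mul_nonneg (v.pos _).le (integralMean_nonneg _ _ _)
  norm_smul c f := by
    rw [norm_def, norm_def, Real.mul_iSup_of_nonneg (norm_nonneg c)]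
    refine iSup_congr fun r => ?_
    have : integralMean p ((c • f : WeightedB0 v p) : ℂ → ℂ) (r : ℝ) = _ :=
      integralMean_smul c f.differentiable.continuous hp.1 (le_of_lt r.2)
    rw [this]
    ring
  norm_triangle f g := by
    have : Nonempty (Set.Ioi (0 : ℝ)) := ⟨⟨1, Set.mem_Ioi.2 zero_lt_one⟩⟩
    refine ciSup_le fun r => ?_
    refine le_trans ?_ (add_le_add (le_ciSup f.bddAbove r) (le_ciSup g.bddAbove r))
    rw [← mul_add]
    exact mul_le_mul_of_nonneg_left (integralMean_add_le f.differentiable.continuous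
      g.differentiable.continuous hp.1 (le_of_lt r.2)) (v.pos _).le
  norm_eq_zero_iff f := by
    constructor
    · intro h
      have key : ∀ z : ℂ, z ≠ 0 → f z = 0 := by
        intro z hz
        have hr : 0 < ‖z‖ := norm_pos_iff.2 hz
        have h1 := le_ciSup f.bddAbove ⟨‖z‖, hr⟩
        rw [← norm_def, h] at h1
        have h2 : integralMean p f ‖z‖ = 0 :=
          le_antisymm (nonpos_of_mul_nonpos_right h1 (v.pos _)) (integralMean_nonneg _ _ _)
        exact eq_zero_of_integralMean_eq_zero f.differentiable.continuous hp.1 h2 rfl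
      have h0 : (f : ℂ → ℂ) = 0 :=
        Continuous.ext_on (dense_compl_singleton (0 : ℂ)) f.differentiable.continuous
          continuous_zero fun z hz => key z hz
      exact Subtype.ext h0
    · rintro rfl
      rw [norm_def]
      have : ∀ r : Set.Ioi (0 : ℝ),
          v ((r : ℝ) : ℂ) * integralMean p ((0 : WeightedB0 v p) : ℂ → ℂ) (r : ℝ) = 0 := by
        intro r
        have : integralMean p ((0 : WeightedB0 v p) : ℂ → ℂ) (r : ℝ) = 0 :=
          integralMean_zero hp.1 (le_of_lt r.2)
        rw [this, mul_zero]
      simp [this]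

instance : NormedAddCommGroup (WeightedB0 v p) := NormedAddCommGroup.ofCore core

instance : NormedSpace ℂ (WeightedB0 v p) := NormedSpace.ofCore core

end WeightedB0

/-! ### Distributional irregularity -/

/-- The upper density `limsup_n card (A ∩ {1, …, n}) / n` of a set of positive integers. -/
def upperDensity (A : Set ℕ) : ℝ :=
  limsup (fun n : ℕ => ((A ∩ Set.Icc 1 n).ncard : ℝ) / (n : ℝ)) atTop

/-- `x` is distributionally irregular for `T`: there are increasing sequences `(n_k)`, `(m_k)` of
positive integers, both of upper density one, with `‖T^{n_k} x‖ → 0` and `‖T^{m_k} x‖ → ∞`. -/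
def IsDistributionallyIrregular {X : Type*} [NormedAddCommGroup X] [NormedSpace ℂ X]
    (T : X →L[ℂ] X) (x : X) : Prop :=
  ∃ n m : ℕ → ℕ, StrictMono n ∧ StrictMono m ∧ (∀ k, 0 < n k) ∧ (∀ k, 0 < m k) ∧
    upperDensity (Set.range n) = 1 ∧ upperDensity (Set.range m) = 1 ∧
    Tendsto (fun k => ‖(T ^ n k) x‖) atTop (𝓝 0) ∧
    Tendsto (fun k => ‖(T ^ m k) x‖) atTop atTop

end

noncomputable section

/-! ### Sets of upper density one -/

/-! The function `exp` is a nonzero fixed vector of `D`: on the circle of radius `r` the bound `cos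
t ≤ 1 - 2t²/π²` and a Gaussian integral give `M_p(exp, r) ≤ C e^r / r^(1/(2p))`, so the growth
hypothesis puts `exp` in the space (`integralMean_exp_le`). Polynomials are dense, and each is
annihilated by a power of `D`. The rest holds for any operator `T` on a separable Banach space with
a fixed vector `e ≠ 0` and a dense generalized kernel.

Approximating a multiple `a • e` by a kernel vector `y` gives `a • e - y`, whose orbit starts small
and ends at the constant `a • e`. Approximating this in turn by a kernel vector gives a bump: small
for a long time, large on a block `[N, kN]`, finally zero (`exists_bump`). Bumps spread over widely
separated times are dealt out among countably many series `x i`. All `x i` are small together after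
each bump dies, and each is large on blocks where the others stay bounded (`exists_seq_blocks`).
Blocks `[A, kA]` force upper density one.

The subspace is spanned by vectors `q s + δ s • x s`, with `q s` in the kernel and `δ s` small,
chosen dense. In a nonzero combination the kernel part dies and some `x i` dominates on its own
blocks. -/

/-- A block `[A, kA]` fills a proportion at least `1 - 1/k` of `{1, …, kA}`. -/
lemma upperDensity_eq_one {S : Set ℕ}
    (h : ∀ k : ℕ, ∃ A, k ≤ A ∧ 0 < A ∧ ∀ j ∈ Set.Icc A (k * A), j ∈ S) : upperDensity S = 1 := by
  have hle : ∀ n : ℕ, ((S ∩ Set.Icc 1 n).ncard : ℝ) / (n : ℝ) ≤ 1 := by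
    intro n
    refine div_le_one_of_le₀ ?_ (Nat.cast_nonneg n)
    have h1 : (S ∩ Set.Icc 1 n).ncard ≤ (Set.Icc 1 n).ncard :=
      Set.ncard_le_ncard Set.inter_subset_right (Set.finite_Icc 1 n)
    rw [← Finset.coe_Icc, Set.ncard_coe_finset, Nat.card_Icc] at h1
    exact_mod_cast (by simpa using h1)
  have hbdd : IsBoundedUnder (· ≤ ·) atTop
      (fun n : ℕ => ((S ∩ Set.Icc 1 n).ncard : ℝ) / (n : ℝ)) :=
    isBoundedUnder_of ⟨1, hle⟩
  have hcob : IsCoboundedUnder (· ≤ ·) atTop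
      (fun n : ℕ => ((S ∩ Set.Icc 1 n).ncard : ℝ) / (n : ℝ)) :=
    IsBoundedUnder.isCoboundedUnder_le (isBoundedUnder_of ⟨0, fun n => by positivity⟩)
  refine le_antisymm (limsup_le_of_le hcob (Eventually.of_forall hle)) ?_
  refine le_of_forall_pos_sub_le fun ε hε => ?_
  refine le_limsup_of_frequently_le ?_ hbdd
  rw [frequently_atTop]
  intro n
  obtain ⟨m, hm⟩ := exists_nat_gt (1 / ε)
  obtain ⟨A, hkA, hA, hS⟩ := h (max (max n m) 1)
  set k := max (max n m) 1 with hk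
  have hk1 : 1 ≤ k := le_max_right _ _
  have hnk : n ≤ k := (le_max_left _ _).trans (le_max_left _ _)
  have hmk : m ≤ k := (le_max_right _ _).trans (le_max_left _ _)
  refine ⟨k * A, by nlinarith, ?_⟩
  have h1 : (Set.Icc A (k * A)).ncard ≤ (S ∩ Set.Icc 1 (k * A)).ncard :=
    Set.ncard_le_ncard (fun j hj => ⟨hS j hj, hA.trans_le hj.1, hj.2⟩)
      ((Set.finite_Icc 1 _).subset Set.inter_subset_right)
  rw [← Finset.coe_Icc, Set.ncard_coe_finset, Nat.card_Icc] at h1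
  have h2 : k * A ≤ (S ∩ Set.Icc 1 (k * A)).ncard + A := by omega
  have h3 : ((k * A : ℕ) : ℝ) ≤ ((S ∩ Set.Icc 1 (k * A)).ncard : ℝ) + A := by exact_mod_cast h2
  have hA' : (0 : ℝ) < A := by exact_mod_cast hA
  have hk' : (0 : ℝ) < k := by exact_mod_cast hk1
  rw [le_div_iff₀ (by push_cast; positivity)]
  have hmk' : (m : ℝ) ≤ k := by exact_mod_cast hmk
  have h4 : 1 ≤ ε * k := by
    have := (div_lt_iff₀ hε).1 (hm.trans_le hmk')
    linarith
  push_cast at h3 ⊢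
  nlinarith

/-- The sequence enumerates the union of one block for each `k`. Terms beyond all blocks of index
below `k` lie in later blocks, where the stronger conditions imply `Q k`. -/
lemma exists_strictMono_upperDensity_eq_one {Q : ℕ → ℕ → Prop}
    (hQ : ∀ k l j, k ≤ l → Q l j → Q k j)
    (h : ∀ k : ℕ, ∃ A, k ≤ A ∧ 0 < A ∧ ∀ j ∈ Set.Icc A (k * A), Q k j) :
    ∃ n : ℕ → ℕ, StrictMono n ∧ (∀ k, 0 < n k) ∧ upperDensity (Set.range n) = 1 ∧
      ∀ k, ∀ᶠ i in atTop, Q k (n i) := by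
  choose A hkA hA hAQ using h
  obtain ⟨S, hS⟩ : ∃ S : Set ℕ, S = {j | ∃ k, j ∈ Set.Icc (A k) (k * A k)} := ⟨_, rfl⟩
  have hinf : S.Infinite := by
    refine Set.infinite_of_not_bddAbove ?_
    rintro ⟨m, hm⟩
    have : A (m + 1) ∈ S := hS ▸ ⟨m + 1, le_rfl, by nlinarith [hA (m + 1)]⟩
    have := hm this
    have := hkA (m + 1)
    omega
  have hmem : ∀ i, ∃ k, Nat.nth (· ∈ S) i ∈ Set.Icc (A k) (k * A k) := fun i => by
    have := Nat.nth_mem_of_infinite hinf i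
    rwa [hS] at this ⊢
  refine ⟨Nat.nth (· ∈ S), Nat.nth_strictMono hinf, fun i => ?_, ?_, fun k => ?_⟩
  · obtain ⟨k, hk, -⟩ := hmem i
    exact (hA k).trans_le hk
  · have hrange : Set.range (Nat.nth (· ∈ S)) = S := Nat.range_nth_of_infinite hinf
    rw [hrange]
    exact upperDensity_eq_one fun k => ⟨A k, hkA k, hA k, fun j hj => hS ▸ ⟨k, hj⟩⟩
  · have ht := (Nat.nth_strictMono hinf).tendsto_atTop
    -- The sum dominates the right endpoint of every block of index below `k`.
    filter_upwards [ht.eventually_gt_atTop (∑ l ∈ Finset.range k, l * A l)] with i hi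
    obtain ⟨l, hl⟩ := hmem i
    refine hQ k l _ ?_ (hAQ l _ hl)
    by_contra! hlk
    have : l * A l ≤ ∑ l ∈ Finset.range k, l * A l :=
      Finset.single_le_sum (f := fun l => l * A l) (fun _ _ => Nat.zero_le _)
        (Finset.mem_range.2 hlk)
    exact absurd (hl.2.trans this) (not_le.2 hi)

/-! ### Distributionally irregular manifolds -/

section Abstract

variable {X : Type*} [NormedAddCommGroup X] [NormedSpace ℂ X] (T : X →L[ℂ] X)

/-- Smallness is written as a product with `k`, not as a bound by `1 / k`, so that it stays monotone
in `k` down to `k = 0`. -/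
lemma isDistributionallyIrregular_of_blocks (x : X)
    (h0 : ∀ k : ℕ, ∃ A, k ≤ A ∧ 0 < A ∧ ∀ j ∈ Set.Icc A (k * A), (k : ℝ) * ‖(T ^ j) x‖ ≤ 1)
    (h1 : ∀ k : ℕ, ∃ A, k ≤ A ∧ 0 < A ∧ ∀ j ∈ Set.Icc A (k * A), (k : ℝ) ≤ ‖(T ^ j) x‖) :
    IsDistributionallyIrregular T x := by
  obtain ⟨n, hn, hn0, hnd, hnQ⟩ := exists_strictMono_upperDensity_eq_one
    (Q := fun k j => (k : ℝ) * ‖(T ^ j) x‖ ≤ 1) (fun k l j hkl h => by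
      have : (k : ℝ) ≤ l := by exact_mod_cast hkl
      exact (mul_le_mul_of_nonneg_right this (norm_nonneg _)).trans h) h0
  obtain ⟨m, hm, hm0, hmd, hmQ⟩ := exists_strictMono_upperDensity_eq_one
    (Q := fun k j => (k : ℝ) ≤ ‖(T ^ j) x‖) (fun k l j hkl h => by
      have : (k : ℝ) ≤ l := by exact_mod_cast hkl
      exact this.trans h) h1
  refine ⟨n, m, hn, hm, hn0, hm0, hnd, hmd, ?_, ?_⟩
  · rw [Metric.tendsto_nhds]
    intro ε hε
    obtain ⟨k, hk⟩ := exists_nat_gt (1 / ε)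
    filter_upwards [hnQ k] with i hi
    rw [dist_zero_right, norm_norm]
    have hk0 : (0 : ℝ) < k := lt_trans (by positivity) hk
    rw [div_lt_iff₀ hε] at hk
    by_contra! hlt
    nlinarith
  · rw [tendsto_atTop]
    intro b
    obtain ⟨k, hk⟩ := exists_nat_gt b
    filter_upwards [hmQ k] with i hi
    exact hk.le.trans hi

variable {T}

lemma pow_apply_eq_zero_of_le {x : X} {N j : ℕ} (h : (T ^ N) x = 0) (hj : N ≤ j) :
    (T ^ j) x = 0 := by
  obtain ⟨d, rfl⟩ := Nat.exists_eq_add_of_le' hj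
  rw [pow_add, mul_apply_eq_comp, h, map_zero]

lemma exists_mem_norm_pow_sub_lt {S : Set X} (hS : Dense S) (x : X) (L : ℕ) {ε : ℝ}
    (hε : 0 < ε) : ∃ y ∈ S, ∀ j ≤ L, ‖(T ^ j) (x - y)‖ < ε := by
  have hev : ∀ᶠ y in 𝓝 x, ∀ j ∈ Finset.range (L + 1), ‖(T ^ j) (x - y)‖ < ε := by
    rw [eventually_all_finset]
    intro j _
    have hc : Continuous fun y => ‖(T ^ j) (x - y)‖ := by fun_prop
    have : Tendsto (fun y => ‖(T ^ j) (x - y)‖) (𝓝 x) (𝓝 0) := by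
      simpa using hc.tendsto x
    exact this.eventually (gt_mem_nhds hε)
  obtain ⟨y, hy, hyS⟩ := mem_closure_iff_nhds.1 (hS x) _ hev
  exact ⟨y, hyS, fun j hj => hy j (Finset.mem_range.2 (by omega))⟩

lemma exists_bump {e : X} (he : e ≠ 0) (hTe : T e = e) (hS : Dense {x : X | ∃ N, (T ^ N) x = 0})
    (k L : ℕ) : ∃ (b : X) (N E L' : ℕ), (∀ j ≤ L, ‖(T ^ j) b‖ ≤ (1 / 2) ^ k) ∧
      L ≤ N ∧ k < N ∧ (∀ j ∈ Set.Icc N (k * N), (k : ℝ) ≤ ‖(T ^ j) b‖) ∧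
      L ≤ E ∧ k < E ∧ (T ^ E) b = 0 ∧ N ≤ L' ∧ k * N ≤ L' ∧ E ≤ L' ∧ k * E ≤ L' := by
  have hpow : ∀ j, (T ^ j) e = e := by
    intro j
    induction j with
    | zero => rfl
    | succ j ih => rw [pow_succ, mul_apply_eq_comp, hTe, ih]
  -- The norm of `a • e` is `k + 1`; the extra unit absorbs the approximation error.
  set a : ℂ := (((k + 1 : ℝ) / ‖e‖ : ℝ) : ℂ) with ha
  have hae : ‖a • e‖ = k + 1 := by
    rw [norm_smul, ha, Complex.norm_real, Real.norm_of_nonneg (by positivity),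
      div_mul_cancel₀ _ (norm_ne_zero_iff.2 he)]
  have hpos : (0 : ℝ) < (1 / 2) ^ k / 2 := by positivity
  -- The orbit of `a • e - y` is small up to time `L` and equals `a • e` from time `N₀` on.
  obtain ⟨y, ⟨N₀, hN₀⟩, hy⟩ := exists_mem_norm_pow_sub_lt (T := T) hS (a • e) L hpos
  set N := N₀ + L + k + 1 with hN
  -- The horizon `L + k * N` covers both the quiet phase `[0, L]` and the large block `[N, kN]`.
  obtain ⟨b, ⟨E₀, hE₀⟩, hb⟩ :=
    exists_mem_norm_pow_sub_lt (T := T) hS (a • e - y) (L + k * N) hpos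
  set E := E₀ + L + k + 1 with hE
  have hk1 : (1 / 2 : ℝ) ^ k ≤ 1 := pow_le_one₀ (by norm_num) (by norm_num)
  -- For `k = 0` the products do not dominate `N` and `E`, hence the separate summands.
  refine ⟨b, N, E, N + k * N + E + k * E, fun j hj => ?_, by omega, by omega, fun j hj => ?_,
    by omega, by omega, pow_apply_eq_zero_of_le hE₀ (by omega), by omega, by omega, by omega,
    by omega⟩
  · have h1 := hy j hj
    have h2 := hb j (by omega)
    have h3 : (T ^ j) b = (T ^ j) (a • e - y) - (T ^ j) (a • e - y - b) := by
      rw [map_sub _ _ b]; abel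
    rw [h3]
    exact (norm_sub_le _ _).trans (by linarith)
  · have h2 := hb j (by have := hj.2; omega)
    have h3 : (T ^ j) b = a • e - (T ^ j) (a • e - y - b) := by
      rw [map_sub _ _ b, map_sub, map_smul, hpow,
        pow_apply_eq_zero_of_le hN₀ (by have := hj.1; omega)]
      abel
    rw [h3]
    have := norm_sub_norm_le (a • e) ((T ^ j) (a • e - y - b))
    rw [hae] at this
    linarith

/-- A sequence of vectors whose orbits are simultaneously small on long blocks, and one of which
is large on long blocks on which the others are small. -/
lemma exists_seq_blocks [CompleteSpace X] {e : X} (he : e ≠ 0) (hTe : T e = e)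
    (hS : Dense {x : X | ∃ N, (T ^ N) x = 0}) :
    ∃ x : ℕ → X,
      (∀ k : ℕ, ∃ A, k ≤ A ∧ 0 < A ∧ ∀ j ∈ Set.Icc A (k * A), ∀ i,
        ‖(T ^ j) (x i)‖ ≤ (1 / 2) ^ k) ∧
      (∀ i k : ℕ, ∃ A, k ≤ A ∧ 0 < A ∧ ∀ j ∈ Set.Icc A (k * A),
        (k : ℝ) ≤ ‖(T ^ j) (x i)‖ ∧ ∀ i', i' ≠ i → ‖(T ^ j) (x i')‖ ≤ 1) := by
  choose b N E L' h1 h2 h3 h4 h5 h6 h7 h8 h9 h10 h11 using exists_bump (T := T) he hTe hS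
  -- Stage `k` occupies the times `[L k, L (k + 1)]`: its bump is small before the stage and zero
  -- after it.
  let L : ℕ → ℕ := fun k => Nat.rec 0 (fun k l => L' k l) k
  have hL : ∀ k, L (k + 1) = L' k (L k) := fun k => rfl
  have hmono : Monotone L := monotone_nat_of_le_succ fun k => by
    rw [hL]; exact (h2 k (L k)).trans (h8 k (L k))
  let c : ℕ → X := fun k => b k (L k)
  have hzero : ∀ l k j, l < k → L k ≤ j → (T ^ j) (c l) = 0 := by
    intro l k j hlk hj
    refine pow_apply_eq_zero_of_le (h7 l (L l)) (le_trans ?_ hj)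
    refine (h10 l (L l)).trans ?_
    rw [← hL]
    exact hmono hlk
  have hsmall : ∀ l k j, k ≤ l → j ≤ L k → ‖(T ^ j) (c l)‖ ≤ (1 / 2) ^ l := fun l k j hkl hj =>
    h1 l (L l) j (hj.trans (hmono hkl))
  -- Unpairing assigns each bump to exactly one series and infinitely many bumps to each series.
  let g : ℕ → ℕ → X := fun i l => if l.unpair.1 = i then c l else 0
  have hg : ∀ i, Summable (g i) := by
    intro i
    refine Summable.of_norm_bounded (g := fun l => (1 / 2 : ℝ) ^ l) summable_geometric_two ?_
    intro l
    by_cases hl : l.unpair.1 = i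
    · simpa [g, hl] using hsmall l l 0 le_rfl (Nat.zero_le _)
    · simp only [g, hl, if_false, norm_zero]; positivity
  have hgeom : ∀ k, HasSum (fun l : ℕ => if l ≤ k then (0 : ℝ) else (1 / 2) ^ l) ((1 / 2) ^ k) := by
    intro k
    rw [← hasSum_nat_add_iff' (k + 1), Finset.sum_eq_zero, sub_zero]
    · have h := (hasSum_geometric_two).mul_left ((1 / 2 : ℝ) ^ (k + 1))
      rw [pow_succ, mul_assoc, one_div_mul_cancel two_ne_zero, mul_one] at h
      refine h.congr_fun fun l => ?_
      rw [if_neg (by omega)]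
      ring
    · intro l hl
      rw [if_pos (by have := Finset.mem_range.1 hl; omega)]
  -- During stage `k` only the bump `k` matters: earlier ones are extinct, and later ones contribute
  -- at most `∑_{l > k} 2^{-l} = 2^{-k}`.
  have hmain : ∀ i k j, L k ≤ j → j ≤ L (k + 1) →
      ‖(T ^ j) (∑' l, g i l) - (T ^ j) (g i k)‖ ≤ (1 / 2) ^ k := by
    intro i k j hj hj'
    have hs : HasSum (fun l => (T ^ j) (g i l) - if l = k then (T ^ j) (g i k) else 0)
        ((T ^ j) (∑' l, g i l) - (T ^ j) (g i k)) :=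
      ((T ^ j).hasSum (hg i).hasSum).sub (hasSum_ite_eq k _)
    refine hs.norm_le_of_bounded (hgeom k) fun l => ?_
    rcases lt_trichotomy l k with hlk | rfl | hlk
    · rw [if_neg hlk.ne, if_pos hlk.le]
      by_cases hl : l.unpair.1 = i <;> simp [g, hl, hzero l k j hlk hj]
    · simp
    · rw [if_neg hlk.ne', if_neg (not_le.2 hlk), sub_zero]
      by_cases hl : l.unpair.1 = i
      · simpa [g, hl] using hsmall l (k + 1) j hlk hj'
      · simp only [g, hl, if_false, map_zero, norm_zero]; positivity
  refine ⟨fun i => ∑' l, g i l, fun k => ?_, fun i k => ?_⟩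
  -- The end of stage `k`, after its own bump has died, is quiet for all series at once.
  · refine ⟨E k (L k), (h6 k (L k)).le, by have := h6 k (L k); omega, fun j hj i => ?_⟩
    have h := hmain i k j ((h5 k (L k)).trans hj.1) (hj.2.trans (h11 k (L k)))
    have h0 : (T ^ j) (g i k) = 0 := by
      have : (T ^ j) (c k) = 0 := pow_apply_eq_zero_of_le (h7 k (L k)) hj.1
      by_cases hl : k.unpair.1 = i <;> simp [g, hl, this]
    rwa [h0, sub_zero] at h
  -- Bump `l` belongs to series `i` and has height at least `k + 1`, which leaves `k` after an error
  -- of at most one.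
  · set l := Nat.pair i (k + 1) with hl
    have hkl : k + 1 ≤ l := Nat.right_le_pair i (k + 1)
    have hli : l.unpair.1 = i := by rw [hl, Nat.unpair_pair]
    have hN := h3 l (L l)
    have hpow : (1 / 2 : ℝ) ^ l ≤ 1 := pow_le_one₀ (by norm_num) (by norm_num)
    refine ⟨N l (L l), by omega, by omega, fun j hj => ?_⟩
    have hj' : j ∈ Set.Icc (N l (L l)) (l * N l (L l)) :=
      ⟨hj.1, hj.2.trans (Nat.mul_le_mul_right _ (by omega))⟩
    have hm := fun i' => hmain i' l j ((h2 l (L l)).trans hj'.1) (hj'.2.trans (h9 l (L l)))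
    refine ⟨?_, fun i' hi' => ?_⟩
    · have h := hm i
      have hb := h4 l (L l) j hj'
      have hgl : g i l = b l (L l) := by simp [g, hli, c]
      rw [hgl] at h
      have h' := norm_sub_norm_le ((T ^ j) (b l (L l))) ((T ^ j) (∑' l, g i l))
      rw [norm_sub_rev] at h'
      have : (k : ℝ) + 1 ≤ l := by exact_mod_cast hkl
      linarith
    · have h := hm i'
      have hgl : g i' l = 0 := by
        simp only [g, hli]; rw [if_neg (Ne.symm hi')]
      rw [hgl, map_zero, sub_zero] at h
      exact h.trans hpow

lemma isDistributionallyIrregular_add_sum {x : ℕ → X}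
    (hx0 : ∀ k : ℕ, ∃ A, k ≤ A ∧ 0 < A ∧ ∀ j ∈ Set.Icc A (k * A), ∀ i,
        ‖(T ^ j) (x i)‖ ≤ (1 / 2) ^ k)
    (hx1 : ∀ i k : ℕ, ∃ A, k ≤ A ∧ 0 < A ∧ ∀ j ∈ Set.Icc A (k * A),
        (k : ℝ) ≤ ‖(T ^ j) (x i)‖ ∧ ∀ i', i' ≠ i → ‖(T ^ j) (x i')‖ ≤ 1)
    {q : X} {N : ℕ} (hq : (T ^ N) q = 0) {s : Finset ℕ} {c : ℕ → ℂ} {i : ℕ} (hi : i ∈ s)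
    (hci : c i ≠ 0) : IsDistributionallyIrregular T (q + ∑ l ∈ s, c l • x l) := by
  have hT : ∀ j, N ≤ j →
      (T ^ j) (q + ∑ l ∈ s, c l • x l) = ∑ l ∈ s, c l • (T ^ j) (x l) := by
    intro j hj
    rw [map_add, pow_apply_eq_zero_of_le hq hj, zero_add, map_sum]
    exact Finset.sum_congr rfl fun l _ => map_smul _ _ _
  set C : ℝ := ∑ l ∈ s, ‖c l‖ with hC
  have hC0 : 0 ≤ C := Finset.sum_nonneg fun _ _ => norm_nonneg _
  have hbound : ∀ (j : ℕ) (t : Finset ℕ) (d : ℝ), t ⊆ s → 0 ≤ d →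
      (∀ l ∈ t, ‖(T ^ j) (x l)‖ ≤ d) → ‖∑ l ∈ t, c l • (T ^ j) (x l)‖ ≤ C * d := by
    intro j t d hts hd h
    refine (norm_sum_le _ _).trans ?_
    rw [hC, Finset.sum_mul]
    refine (Finset.sum_le_sum fun l hl => ?_).trans
      (Finset.sum_le_sum_of_subset_of_nonneg hts fun l _ _ => by positivity)
    rw [norm_smul]
    exact mul_le_mul_of_nonneg_left (h l hl) (norm_nonneg _)
  refine isDistributionallyIrregular_of_blocks T _ (fun k => ?_) (fun k => ?_)
  -- A quiet block of index `n ≥ N` starts after the kernel part has vanished; a large `n` beats the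
  -- factor `k * C`.
  · have hlim : Tendsto (fun n : ℕ => (k : ℝ) * (C * (1 / 2) ^ n)) atTop (𝓝 0) := by
      simpa using ((tendsto_pow_atTop_nhds_zero_of_lt_one (r := (1 / 2 : ℝ)) (by norm_num)
        (by norm_num)).const_mul C).const_mul (k : ℝ)
    obtain ⟨n, hn, hnk⟩ := ((hlim.eventually (gt_mem_nhds zero_lt_one)).and
      (eventually_ge_atTop (max k N))).exists
    have hkn : k ≤ n := (le_max_left _ _).trans hnk
    have hNn : N ≤ n := (le_max_right _ _).trans hnk
    obtain ⟨A, hA, hA0, h⟩ := hx0 n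
    refine ⟨A, hkn.trans hA, hA0, fun j hj => ?_⟩
    rw [hT j (hNn.trans (hA.trans hj.1))]
    refine le_trans (mul_le_mul_of_nonneg_left (hbound j s _ subset_rfl (by positivity)
      fun l _ => ?_) (Nat.cast_nonneg k)) hn.le
    exact h j ⟨hj.1, hj.2.trans (Nat.mul_le_mul_right _ hkn)⟩ l
  -- The term of index `i` exceeds `k + C`, while the others sum to at most `C`.
  · obtain ⟨n₀, hn₀⟩ := exists_nat_gt ((k + C) / ‖c i‖)
    obtain ⟨A, hA, hA0, h⟩ := hx1 i (n₀ + k + N)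
    refine ⟨A, by omega, hA0, fun j hj => ?_⟩
    rw [hT j (by have := hj.1; omega), ← Finset.add_sum_erase s _ hi]
    obtain ⟨hj1, hj2⟩ := h j ⟨hj.1, hj.2.trans (Nat.mul_le_mul_right _ (by omega))⟩
    have h1 := hbound j (s.erase i) 1 (Finset.erase_subset _ _) zero_le_one fun l hl =>
      hj2 l (Finset.ne_of_mem_erase hl)
    have h2 := norm_sub_le_norm_add (c i • (T ^ j) (x i)) (∑ l ∈ s.erase i, c l • (T ^ j) (x l))
    rw [norm_smul] at h2
    have hc : 0 < ‖c i‖ := norm_pos_iff.2 hci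
    have h3 : (n₀ : ℝ) ≤ ‖(T ^ j) (x i)‖ := by
      refine le_trans ?_ hj1
      push_cast
      have : (0 : ℝ) ≤ k := Nat.cast_nonneg k
      have : (0 : ℝ) ≤ N := Nat.cast_nonneg N
      linarith
    rw [div_lt_iff₀ hc] at hn₀
    nlinarith

/-- An operator with a nonzero fixed vector and a dense generalized kernel on a separable Banach
space has a dense subspace of distributionally irregular vectors. -/
theorem exists_dense_submodule_isDistributionallyIrregular [CompleteSpace X]
    [TopologicalSpace.SeparableSpace X] {e : X} (he : e ≠ 0) (hTe : T e = e)
    (hS : Dense {x : X | ∃ N, (T ^ N) x = 0}) :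
    ∃ M : Submodule ℂ X, Dense (M : Set X) ∧
      ∀ f ∈ M, f ≠ 0 → IsDistributionallyIrregular T f := by
  obtain ⟨x, hx0, hx1⟩ := exists_seq_blocks (T := T) he hTe hS
  let d : ℕ → X := TopologicalSpace.denseSeq X
  -- The index `s` encodes a pair `(n, m)`: the target `d n` and the precision `1 / (m + 1)`.
  have hq : ∀ s : ℕ, ∃ q : X, (∃ N, (T ^ N) q = 0) ∧
      ‖d s.unpair.1 - q‖ < 1 / ((s.unpair.2 : ℝ) + 1) := by
    intro s
    obtain ⟨q, hq, h⟩ := exists_mem_norm_pow_sub_lt (T := T) hS (d s.unpair.1) 0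
      (ε := 1 / ((s.unpair.2 : ℝ) + 1)) (by positivity)
    exact ⟨q, hq, by simpa using h 0 le_rfl⟩
  choose q hqN hqd using hq
  have hδ : ∀ s : ℕ, ∃ δ : ℝ, 0 < δ ∧ δ * ‖x s‖ ≤ 1 / ((s.unpair.2 : ℝ) + 1) := by
    intro s
    refine ⟨1 / ((s.unpair.2 : ℝ) + 1) / (‖x s‖ + 1), by positivity, ?_⟩
    rw [div_mul_eq_mul_div]
    refine div_le_of_le_mul₀ (by positivity) (by positivity) ?_
    exact mul_le_mul_of_nonneg_left (by linarith) (by positivity)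
  choose δ hδ0 hδ using hδ
  let w : ℕ → X := fun s => q s + (δ s : ℂ) • x s
  refine ⟨Submodule.span ℂ (Set.range w), ?_, fun f hf hf0 => ?_⟩
  · refine Dense.mono Submodule.subset_span ?_
    rw [Metric.dense_iff]
    intro y r hr
    obtain ⟨m, hm⟩ := exists_nat_one_div_lt (show 0 < r / 3 by positivity)
    obtain ⟨_, hz, ⟨n, rfl⟩⟩ :=
      (Metric.dense_iff.1 (TopologicalSpace.denseRange_denseSeq X)) y (r / 3) (by positivity)
    refine ⟨w (Nat.pair n m), ?_, ⟨_, rfl⟩⟩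
    have h1 := hqd (Nat.pair n m)
    have h2 := hδ (Nat.pair n m)
    rw [Nat.unpair_pair] at h1 h2
    rw [Metric.mem_ball, dist_eq_norm] at hz ⊢
    have h3 : w (Nat.pair n m) - y = (d n - y) - (d n - q (Nat.pair n m)) +
        (δ (Nat.pair n m) : ℂ) • x (Nat.pair n m) := by
      simp only [w]; abel
    rw [h3]
    have h4 : ‖(δ (Nat.pair n m) : ℂ) • x (Nat.pair n m)‖ =
        δ (Nat.pair n m) * ‖x (Nat.pair n m)‖ := by
      rw [norm_smul, Complex.norm_real, Real.norm_of_nonneg (hδ0 _).le]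
    have h5 := norm_add_le ((d n - y) - (d n - q (Nat.pair n m)))
      ((δ (Nat.pair n m) : ℂ) • x (Nat.pair n m))
    have h6 := norm_sub_le (d n - y) (d n - q (Nat.pair n m))
    simp only [d] at *
    linarith
  · obtain ⟨c, rfl⟩ := (Finsupp.mem_span_range_iff_exists_finsupp).1 hf
    have hc : ∃ i ∈ c.support, c i ≠ 0 := by
      by_contra! h
      refine hf0 ?_
      exact Finset.sum_eq_zero fun i hi => by simp [h i hi]
    obtain ⟨i, hi, hci⟩ := hc
    have hN : ∃ N, (T ^ N) (∑ l ∈ c.support, c l • q l) = 0 := by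
      choose N hN using hqN
      refine ⟨∑ l ∈ c.support, N l, ?_⟩
      rw [map_sum]
      refine Finset.sum_eq_zero fun l hl => ?_
      rw [map_smul, pow_apply_eq_zero_of_le (hN l)
        (Finset.single_le_sum (fun _ _ => Nat.zero_le _) hl), smul_zero]
    obtain ⟨N, hN⟩ := hN
    have key := isDistributionallyIrregular_add_sum hx0 hx1 hN hi (c := fun l => c l * δ l)
      (mul_ne_zero hci (by exact_mod_cast (hδ0 i).ne'))
    convert key using 1
    simp only [w, Finsupp.sum, smul_add, Finset.sum_add_distrib, smul_smul]

end Abstract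

/-! ### Further facts on integral means -/

lemma le_integralMean_add {f g : ℂ → ℂ} (hf : Continuous f) (hg : Continuous g) {p : ℝ≥0∞}
    (hp1 : 1 ≤ p) {r : ℝ} (hr : 0 ≤ r) :
    integralMean p f r ≤ integralMean p g r + integralMean p (f - g) r := by
  have := integralMean_add_le hg (hf.sub hg) hp1 hr
  rwa [add_sub_cancel] at this

lemma integralMean_sub_comm {f g : ℂ → ℂ} (hf : Continuous f) (hg : Continuous g) {p : ℝ≥0∞}
    (hp1 : 1 ≤ p) {r : ℝ} (hr : 0 ≤ r) :
    integralMean p (f - g) r = integralMean p (g - f) r := by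
  have := integralMean_smul (-1) (hg.sub hf) hp1 hr
  rw [norm_neg, norm_one, one_mul, neg_smul, one_smul, neg_sub] at this
  exact this

/-- Total mass one makes the means monotone in the exponent without a constant. -/
instance : IsProbabilityMeasure circleParamMeasure where
  measure_univ := by
    have h : (0 : ℝ) < 2 * Real.pi := by positivity
    rw [circleParamMeasure, Measure.smul_apply, Measure.restrict_apply_univ, Real.volume_Ioc,
      sub_zero, smul_eq_mul, ← ENNReal.ofReal_mul (by positivity), one_div_mul_cancel h.ne',
      ENNReal.ofReal_one]

lemma integralMean_one_le {f : ℂ → ℂ} (hf : Continuous f) {p : ℝ≥0∞} (hp1 : 1 ≤ p)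
    {r : ℝ} (hr : 0 ≤ r) : integralMean 1 f r ≤ integralMean p f r := by
  by_cases hp : p = ∞
  · refine integralMean_le_of_bound le_rfl hr fun z hz => ?_
    rw [integralMean, if_pos hp]
    exact le_ciSup (bddAbove_sphere hf r) (⟨z, by simpa using hz⟩ : Metric.sphere (0 : ℂ) r)
  · rw [integralMean_eq hf one_ne_zero ENNReal.one_ne_top hr,
      integralMean_eq hf (zero_lt_one.trans_le hp1).ne' hp hr]
    exact ENNReal.toReal_mono (memLp_circle hf p hr).eLpNorm_ne_top
      (eLpNorm_le_eLpNorm_of_exponent_le hp1 (continuous_circle hf r).aestronglyMeasurable)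

/-- Cauchy's integral formula, with the absolute value taken inside the integral. -/
lemma norm_iteratedDeriv_mul_pow_le {f : ℂ → ℂ} (hf : Differentiable ℂ f) (n : ℕ) {r : ℝ}
    (hr : 0 < r) : ‖(n.factorial : ℂ)⁻¹ * iteratedDeriv n f 0‖ * r ^ n ≤ integralMean 1 f r := by
  have h := (hf.diffContOnCl (s := Metric.ball 0 r)).circleIntegral_one_div_sub_center_pow_smul
    hr n
  have h1 : ‖∮ z in C(0, r), (1 / (z - 0) ^ (n + 1)) • f z‖ ≤
      ∫ t in (0 : ℝ)..(2 * Real.pi),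
        (r ^ n)⁻¹ * ‖f ((r : ℂ) * Complex.exp ((t : ℂ) * Complex.I))‖ := by
    rw [circleIntegral]
    refine (intervalIntegral.norm_integral_le_integral_norm (by positivity)).trans (le_of_eq ?_)
    refine intervalIntegral.integral_congr fun t _ => ?_
    simp only [deriv_circleMap, smul_eq_mul, norm_mul, norm_div, norm_pow, norm_one,
      sub_zero, Complex.norm_I, mul_one, abs_of_pos hr, circleMap, zero_add,
      Complex.norm_real, Real.norm_eq_abs, Complex.norm_exp_ofReal_mul_I]
    field_simp
    ring
  rw [intervalIntegral.integral_const_mul, h, norm_smul, norm_div] at h1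
  have h2 : integralMean 1 f r = (1 / (2 * Real.pi)) * ∫ t in (0 : ℝ)..(2 * Real.pi),
      ‖f ((r : ℂ) * Complex.exp ((t : ℂ) * Complex.I))‖ := by
    simp [integralMean]
  rw [h2, norm_mul, norm_inv]
  simp only [norm_mul, Complex.norm_ofNat, Complex.norm_real, Real.norm_of_nonneg Real.pi_pos.le,
    Complex.norm_I, mul_one] at h1
  rw [inv_mul_eq_div, le_div_iff₀ (by positivity)] at h1
  rw [one_div_mul_eq_div, le_div_iff₀ (by positivity)]
  refine le_trans (le_of_eq ?_) h1
  ring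

lemma integralMean_dilate_le {f : ℂ → ℂ} (hf : Continuous f) {p : ℝ≥0∞} (hp1 : 1 ≤ p)
    {ρ r : ℝ} (hρ : 0 ≤ ρ) (hr : 0 ≤ r) :
    integralMean p (fun z => f (ρ * z)) r ≤ integralMean p f (ρ * r) := by
  by_cases hp : p = ∞
  · refine integralMean_le_of_bound hp1 hr fun z hz => ?_
    rw [integralMean, if_pos hp]
    exact le_ciSup (bddAbove_sphere hf (ρ * r))
      (⟨ρ * z, by simp [hz, abs_of_nonneg hρ]⟩ : Metric.sphere (0 : ℂ) (ρ * r))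
  · simp [integralMean, if_neg hp, mul_assoc]

lemma integralMean_exp_le {p : ℝ≥0∞} (hp1 : 1 ≤ p) :
    ∃ C : ℝ, ∀ r : ℝ, 0 < r →
      integralMean p Complex.exp r ≤ C * (Real.exp r / r ^ (1 / (2 * p)).toReal) := by
  by_cases hp : p = ∞
  · refine ⟨1, fun r hr => integralMean_le_of_bound hp1 hr.le fun z hz => ?_⟩
    have : (1 / (2 * p)).toReal = 0 := by simp [hp]
    rw [this, Real.rpow_zero, div_one, one_mul, Complex.norm_exp]
    exact Real.exp_le_exp.2 ((Complex.re_le_norm z).trans hz.le)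
  · set q := p.toReal with hq
    have hq0 : 0 < q := ENNReal.toReal_pos (zero_lt_one.trans_le hp1).ne' hp
    have hexp : (1 / (2 * p)).toReal = 1 / 2 * (1 / q) := by
      simp [hq, mul_comm]
    -- `K` is what remains of the normalized Gaussian integral `√(π / b) / (2π)` once `r^(-1/2)` is
    -- factored out.
    set K : ℝ := 1 / (2 * Real.pi) * Real.sqrt (Real.pi / (q * (2 / Real.pi ^ 2))) with hK
    have hK0 : 0 ≤ K := by positivity
    refine ⟨K ^ (1 / q), fun r hr => ?_⟩
    set b : ℝ := q * r * (2 / Real.pi ^ 2) with hb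
    have hb0 : 0 < b := by positivity
    have hnorm : ∀ t : ℝ, ‖Complex.exp ((r : ℂ) * Complex.exp ((t : ℂ) * Complex.I))‖ ^ q =
        Real.exp (q * r * Real.cos t) := by
      intro t
      rw [Complex.norm_exp, Complex.re_ofReal_mul, Complex.exp_ofReal_mul_I_re, ← Real.exp_mul]
      ring_nf
    have hper : Function.Periodic (fun t : ℝ => Real.exp (q * r * Real.cos t)) (2 * Real.pi) :=
      fun t => by simp only [Real.cos_add_two_pi]
    have hint : ∫ t in (0 : ℝ)..(2 * Real.pi), Real.exp (q * r * Real.cos t) ≤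
        Real.exp (q * r) * Real.sqrt (Real.pi / b) := by
      -- The quadratic bound on the cosine holds on `[-π, π]`, so the period is shifted there.
      have h0 := hper.intervalIntegral_add_eq 0 (-Real.pi)
      rw [zero_add, show -Real.pi + 2 * Real.pi = Real.pi by ring] at h0
      rw [h0, ← integral_gaussian, ← integral_const_mul]
      have hpi : -Real.pi ≤ Real.pi := by linarith [Real.pi_pos]
      have hgi : Integrable fun t : ℝ => Real.exp (q * r) * Real.exp (-b * t ^ 2) :=
        (integrable_exp_neg_mul_sq hb0).const_mul _
      calc ∫ t in (-Real.pi)..Real.pi, Real.exp (q * r * Real.cos t)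
          ≤ ∫ t in (-Real.pi)..Real.pi, Real.exp (q * r) * Real.exp (-b * t ^ 2) := by
            refine intervalIntegral.integral_mono_on hpi
              (Continuous.intervalIntegrable (by fun_prop) _ _) hgi.intervalIntegrable
              fun t ht => ?_
            rw [← Real.exp_add]
            refine Real.exp_le_exp.2 ?_
            have h1 := Real.cos_le_one_sub_mul_cos_sq (x := t) (abs_le.2 ht)
            have h2 := mul_le_mul_of_nonneg_left h1 (by positivity : 0 ≤ q * r)
            refine h2.trans (le_of_eq ?_)
            rw [hb]; ring
        _ ≤ ∫ t : ℝ, Real.exp (q * r) * Real.exp (-b * t ^ 2) := by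
            rw [intervalIntegral.integral_of_le hpi]
            exact setIntegral_le_integral hgi (Eventually.of_forall fun t => by positivity)
    have hsqrt : 1 / (2 * Real.pi) * Real.sqrt (Real.pi / b) = K * (r ^ (1 / 2 : ℝ))⁻¹ := by
      rw [hK, mul_assoc, ← Real.sqrt_eq_rpow, ← Real.sqrt_inv, ← Real.sqrt_mul (by positivity), hb]
      congr 2
      field_simp
    have hle : 1 / (2 * Real.pi) * ∫ t in (0 : ℝ)..(2 * Real.pi), Real.exp (q * r * Real.cos t) ≤
        K * (Real.exp (q * r) * (r ^ (1 / 2 : ℝ))⁻¹) := by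
      refine (mul_le_mul_of_nonneg_left hint (by positivity)).trans (le_of_eq ?_)
      rw [mul_left_comm, hsqrt]; ring
    have h0 : 0 ≤ ∫ t in (0 : ℝ)..(2 * Real.pi), Real.exp (q * r * Real.cos t) :=
      intervalIntegral.integral_nonneg (by positivity) fun t _ => by positivity
    rw [integralMean, if_neg hp]
    simp only [← hq, hnorm]
    refine (Real.rpow_le_rpow (by positivity) hle (by positivity)).trans (le_of_eq ?_)
    rw [Real.mul_rpow (x := K) hK0 (by positivity),
      Real.mul_rpow (x := Real.exp (q * r)) (by positivity) (by positivity),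
      ← Real.exp_mul, Real.inv_rpow (by positivity), ← Real.rpow_mul hr.le, hexp,
      show q * r * (1 / q) = r by field_simp, div_eq_mul_inv (Real.exp r)]

/-! ### Taylor coefficients, point evaluations and completeness -/

namespace WeightedB0

variable {v : RadialWeight} {p : ℝ≥0∞} [hp : Fact (1 ≤ p)]

@[ext]
lemma ext {f g : WeightedB0 v p} (h : ∀ z, f z = g z) : f = g := Subtype.ext (funext h)

lemma continuous (f : WeightedB0 v p) : Continuous (f : ℂ → ℂ) := f.differentiable.continuous

lemma norm_le (f : WeightedB0 v p) {C : ℝ}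
    (h : ∀ r : ℝ, 0 < r → v (r : ℂ) * integralMean p f r ≤ C) : ‖f‖ ≤ C := by
  have : Nonempty (Set.Ioi (0 : ℝ)) := ⟨⟨1, Set.mem_Ioi.2 zero_lt_one⟩⟩
  exact ciSup_le fun r => h r r.2

lemma le_norm (f : WeightedB0 v p) {r : ℝ} (hr : 0 < r) :
    v (r : ℂ) * integralMean p f r ≤ ‖f‖ :=
  le_ciSup f.bddAbove ⟨r, hr⟩

/-- The Taylor coefficients at the origin. -/
def coeff (f : WeightedB0 v p) (n : ℕ) : ℂ := (n.factorial : ℂ)⁻¹ * iteratedDeriv n f 0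

lemma hasSum_coeff (f : WeightedB0 v p) (z : ℂ) : HasSum (fun n => f.coeff n * z ^ n) (f z) := by
  have := Complex.hasSum_taylorSeries_of_entire f.differentiable 0 z
  refine this.congr_fun fun n => ?_
  simp only [coeff, sub_zero, smul_eq_mul]
  ring

lemma coeff_mul_pow_le (f : WeightedB0 v p) (n : ℕ) {r : ℝ} (hr : 0 < r) :
    v (r : ℂ) * (‖f.coeff n‖ * r ^ n) ≤ ‖f‖ :=
  (mul_le_mul_of_nonneg_left ((norm_iteratedDeriv_mul_pow_le f.differentiable n hr).trans
    (integralMean_one_le f.continuous hp.1 hr.le)) (v.pos _).le).trans (f.le_norm hr)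

/-- The coefficient bounds sum to a geometric series of ratio `1/2`, whence the factor 2. Norm
convergence thus implies locally uniform convergence. -/
lemma norm_apply_le (f : WeightedB0 v p) {z : ℂ} {r : ℝ} (hr : 0 < r) (hz : ‖z‖ ≤ r / 2) :
    ‖f z‖ ≤ 2 / v (r : ℂ) * ‖f‖ := by
  have h := (hasSum_geometric_two).mul_left (‖f‖ / v (r : ℂ))
  refine ((f.hasSum_coeff z).norm_le_of_bounded h fun n => ?_).trans (le_of_eq (by ring))
  have h1 := f.coeff_mul_pow_le n hr
  rw [norm_mul, norm_pow]
  calc ‖f.coeff n‖ * ‖z‖ ^ n ≤ ‖f.coeff n‖ * (r / 2) ^ n := by gcongr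
    _ = (v (r : ℂ) * (‖f.coeff n‖ * r ^ n)) / v (r : ℂ) * (1 / 2) ^ n := by
      rw [mul_div_cancel_left₀ _ (v.pos (r : ℂ)).ne', div_pow, div_pow, one_pow]
      ring
    _ ≤ ‖f‖ / v (r : ℂ) * (1 / 2) ^ n := by
      gcongr
      exact (v.pos _).le

/-- Evaluation at a point. -/
def evalCLM (z : ℂ) : WeightedB0 v p →L[ℂ] ℂ :=
  LinearMap.mkContinuous
    { toFun := fun f : WeightedB0 v p => f z
      map_add' := fun _ _ => rfl
      map_smul' := fun _ _ => rfl } (2 / v ((2 * ‖z‖ + 2 : ℝ) : ℂ))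
    -- The radius `2‖z‖ + 2` remains positive at `z = 0`.
    fun f => f.norm_apply_le (by positivity) (by linarith)

@[simp]
lemma evalCLM_apply (z : ℂ) (f : WeightedB0 v p) : evalCLM z f = f z := rfl

lemma tendsto_of_integralMean_sub_le {u : ℕ → WeightedB0 v p} {g : ℂ → ℂ}
    (hg : Differentiable ℂ g)
    (h : ∀ ε > 0, ∃ N, ∀ n ≥ N, ∀ r : ℝ, 0 < r → v (r : ℂ) * integralMean p (g - u n) r ≤ ε) :
    ∃ a, Tendsto u atTop (𝓝 a) := by
  have hmem : Tendsto (fun r : ℝ => v (r : ℂ) * integralMean p g r) atTop (𝓝 0) := by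
    rw [Metric.tendsto_nhds]
    intro ε hε
    obtain ⟨N, hN⟩ := h (ε / 2) (by positivity)
    filter_upwards [(u N).2.2.eventually (gt_mem_nhds (show (0 : ℝ) < ε / 2 by positivity)),
      eventually_gt_atTop 0] with r hr hr0
    rw [dist_zero_right, Real.norm_of_nonneg
      (mul_nonneg (v.pos _).le (integralMean_nonneg _ _ _))]
    have h1 := mul_le_mul_of_nonneg_left
      (le_integralMean_add hg.continuous (u N).continuous hp.1 hr0.le) (v.pos (r : ℂ)).le
    have h2 := hN N le_rfl r hr0
    rw [mul_add] at h1
    linarith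
  let G : WeightedB0 v p := ⟨g, hg, hmem⟩
  refine ⟨G, ?_⟩
  rw [Metric.tendsto_atTop]
  intro ε hε
  obtain ⟨N, hN⟩ := h (ε / 2) (by positivity)
  refine ⟨N, fun n hn => ?_⟩
  rw [dist_comm, dist_eq_norm]
  have : ‖G - u n‖ ≤ ε / 2 := norm_le _ fun r hr => hN n hn r hr
  linarith

instance : CompleteSpace (WeightedB0 v p) := by
  refine Metric.complete_of_cauchySeq_tendsto fun u hu => ?_
  have hpt : ∀ z : ℂ, ∃ w, Tendsto (fun n => u n z) atTop (𝓝 w) := fun z =>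
    cauchySeq_tendsto_of_complete
      ((evalCLM (v := v) (p := p) z).uniformContinuous.comp_cauchySeq hu)
  choose g hg using hpt
  have hunif : ∀ R > 0, ∀ ε > 0, ∃ N, ∀ n ≥ N, ∀ z : ℂ, ‖z‖ ≤ R / 2 → ‖g z - u n z‖ ≤ ε := by
    intro R hR ε hε
    have hv := v.pos (R : ℂ)
    obtain ⟨N, hN⟩ := Metric.cauchySeq_iff.1 hu (ε / (2 / v (R : ℂ))) (by positivity)
    refine ⟨N, fun n hn z hz => ?_⟩
    refine le_of_tendsto (((hg z).sub_const (u n z)).norm) ?_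
    filter_upwards [eventually_ge_atTop N] with m hm
    have h1 := (u m - u n).norm_apply_le hR hz
    have h2 := (hN m hm n hn).le
    rw [dist_eq_norm, le_div_iff₀' (by positivity)] at h2
    exact h1.trans h2
  have hdiff : Differentiable ℂ g := by
    intro z
    have hball : DifferentiableOn ℂ g (Metric.ball 0 (‖z‖ + 1)) := by
      refine TendstoLocallyUniformlyOn.differentiableOn (F := fun n => (u n : ℂ → ℂ))
        (φ := atTop) (TendstoUniformlyOn.tendstoLocallyUniformlyOn ?_)
        (Eventually.of_forall fun n => (u n).differentiable.differentiableOn) Metric.isOpen_ball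
      rw [Metric.tendstoUniformlyOn_iff]
      intro ε hε
      obtain ⟨N, hN⟩ := hunif (2 * (‖z‖ + 1)) (by positivity) (ε / 2) (by positivity)
      filter_upwards [eventually_ge_atTop N] with n hn w hw
      rw [dist_eq_norm]
      have := hN n hn w (by rw [mul_div_cancel_left₀ _ two_ne_zero]; exact (mem_ball_zero_iff.1 hw).le)
      linarith
    exact hball.differentiableAt (Metric.isOpen_ball.mem_nhds (by simp))
  refine tendsto_of_integralMean_sub_le hdiff fun ε hε => ?_
  obtain ⟨N, hN⟩ := Metric.cauchySeq_iff.1 hu ε hε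
  -- `N` must not depend on `r`. The auxiliary index `m` may: it makes `g - u m` small on the circle
  -- of radius `r`, and its error `δ` is arbitrary.
  refine ⟨N, fun n hn r hr => le_of_forall_pos_le_add fun δ hδ => ?_⟩
  have hv := v.pos (r : ℂ)
  obtain ⟨N', hN'⟩ := hunif (2 * r) (by positivity) (δ / v (r : ℂ)) (by positivity)
  set m := max N N' with hm
  have h1 : integralMean p (g - u m) r ≤ δ / v (r : ℂ) :=
    integralMean_le_of_bound hp.1 hr.le fun z hz => hN' m (le_max_right _ _) z (by linarith)
  have h2 : v (r : ℂ) * integralMean p ((u m - u n : WeightedB0 v p) : ℂ → ℂ) r ≤ ε :=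
    ((u m - u n).le_norm hr).trans (by
      have := (hN m (le_max_left _ _) n hn).le
      rwa [dist_eq_norm] at this)
  have h3 := integralMean_add_le (u m - u n).continuous
    (hdiff.continuous.sub (u m).continuous) hp.1 hr.le
  have h4 : ((u m - u n : WeightedB0 v p) : ℂ → ℂ) + (g - u m) = g - u n := by
    change ((u m : ℂ → ℂ) - u n) + (g - u m) = g - u n
    abel
  rw [h4] at h3
  rw [le_div_iff₀' hv] at h1
  have h5 := mul_le_mul_of_nonneg_left h3 hv.le
  rw [mul_add] at h5
  linarith

/-! ### Density of the polynomials -/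

/-- The monomials. -/
def monomial (v : RadialWeight) (p : ℝ≥0∞) [hp : Fact (1 ≤ p)] (n : ℕ) : WeightedB0 v p :=
  ⟨fun z => z ^ n, differentiable_pow n, by
    refine tendsto_of_tendsto_of_tendsto_of_le_of_le' tendsto_const_nhds (v.decay n)
      (Eventually.of_forall fun r => mul_nonneg (v.pos _).le (integralMean_nonneg _ _ _)) ?_
    filter_upwards [eventually_ge_atTop 0] with r hr
    rw [mul_comm]
    refine mul_le_mul_of_nonneg_right ?_ (v.pos _).le
    exact integralMean_le_of_bound hp.1 hr fun z hz => by simp [hz]⟩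

@[simp]
lemma monomial_apply (n : ℕ) (z : ℂ) : monomial v p n z = z ^ n := rfl

/-- The dilation `z ↦ f (ρ z)`. -/
def dilate (f : WeightedB0 v p) (ρ : ℝ) (h0 : 0 < ρ) (h1 : ρ ≤ 1) : WeightedB0 v p :=
  ⟨fun z => f (ρ * z), f.differentiable.comp (differentiable_id.const_mul (ρ : ℂ)), by
    have h := f.2.2.comp (tendsto_id.const_mul_atTop h0)
    refine tendsto_of_tendsto_of_tendsto_of_le_of_le' tendsto_const_nhds h
      (Eventually.of_forall fun r => mul_nonneg (v.pos _).le (integralMean_nonneg _ _ _)) ?_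
    filter_upwards [eventually_ge_atTop 0] with r hr
    refine mul_le_mul ?_ (integralMean_dilate_le f.continuous hp.1 h0.le hr)
      (integralMean_nonneg _ _ _) (v.pos _).le
    exact v.antitone (Set.mem_Ici.2 (by simp only [id]; positivity)) hr
      (by simp only [id]; nlinarith)⟩

lemma norm_coeff_smul_monomial_le (f : WeightedB0 v p) (n : ℕ) :
    ‖f.coeff n • monomial v p n‖ ≤ ‖f‖ := by
  refine norm_le _ fun r hr => le_trans ?_ (f.coeff_mul_pow_le n hr)
  refine mul_le_mul_of_nonneg_left ?_ (v.pos _).le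
  refine integralMean_le_of_bound hp.1 hr.le fun z hz => le_of_eq ?_
  change ‖f.coeff n * z ^ n‖ = _
  rw [norm_mul, norm_pow, hz]

/-- The Taylor terms of `f` are only known to be bounded in norm; dilation supplies the factor `ρ ^
n`, which makes the series converge absolutely. Point evaluations identify its sum. -/
lemma dilate_mem_closure (f : WeightedB0 v p) {ρ : ℝ} (h0 : 0 < ρ) (h1 : ρ < 1) :
    f.dilate ρ h0 h1.le ∈
      closure (Submodule.span ℂ (Set.range (monomial v p)) : Set (WeightedB0 v p)) := by
  have hs : Summable fun n => ((ρ : ℂ) ^ n) • f.coeff n • monomial v p n := by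
    refine Summable.of_norm_bounded
      ((summable_geometric_of_lt_one h0.le h1).mul_right ‖f‖) fun n => ?_
    rw [norm_smul, norm_pow, Complex.norm_real, Real.norm_of_nonneg h0.le]
    exact mul_le_mul_of_nonneg_left (f.norm_coeff_smul_monomial_le n) (by positivity)
  have heq : ∑' n, ((ρ : ℂ) ^ n) • f.coeff n • monomial v p n = f.dilate ρ h0 h1.le := by
    ext z
    have hz := (evalCLM (v := v) (p := p) z).hasSum hs.hasSum
    rw [evalCLM_apply] at hz
    refine hz.unique ((f.hasSum_coeff (ρ * z)).congr_fun fun n => ?_)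
    simp only [map_smul, evalCLM_apply, monomial_apply, smul_eq_mul, mul_pow]
    ring
  rw [← heq]
  refine mem_closure_of_tendsto hs.hasSum (Eventually.of_forall fun s => ?_)
  exact Submodule.sum_mem _ fun n _ => Submodule.smul_mem _ _ (Submodule.smul_mem _ _
    (Submodule.subset_span ⟨n, rfl⟩))

/-- Uniform continuity handles bounded radii. For large `r`, both `f` and its dilation are small,
since `v(r) M_p(f, ρr) ≤ v(ρr) M_p(f, ρr)`. -/
lemma exists_norm_sub_dilate_le (f : WeightedB0 v p) {ε : ℝ} (hε : 0 < ε) :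
    ∃ (ρ : ℝ) (h0 : 0 < ρ) (h1 : ρ < 1), ‖f - f.dilate ρ h0 h1.le‖ ≤ ε := by
  obtain ⟨R₀, hR₀⟩ := eventually_atTop.1
    (f.2.2.eventually (gt_mem_nhds (show (0 : ℝ) < ε / 2 by positivity)))
  set R := max R₀ 1 with hR
  have hR1 : 1 ≤ R := le_max_right _ _
  have hR' : ∀ r, R ≤ r → v (r : ℂ) * integralMean p f r < ε / 2 := fun r hr =>
    hR₀ r ((le_max_left _ _).trans hr)
  have hv0 := v.pos 0
  obtain ⟨δ, hδ, huc⟩ := Metric.uniformContinuousOn_iff.1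
    ((isCompact_closedBall (0 : ℂ) (2 * R)).uniformContinuousOn_of_continuous
      f.continuous.continuousOn) (ε / v 0) (by positivity)
  -- The bound `1 / 2` keeps `(1 - τ) r ≥ R` when `r ≥ 2R`; the other moves points of the disc of
  -- radius `2R` by less than `δ`.
  obtain ⟨τ, hτ0, hτ⟩ : ∃ τ : ℝ, 0 < τ ∧ τ < min (1 / 2) (δ / (2 * R)) :=
    exists_between (by positivity)
  have hτ1 : τ < 1 / 2 := hτ.trans_le (min_le_left _ _)
  have hτ2 : τ * (2 * R) < δ := (lt_div_iff₀ (by positivity)).1 (hτ.trans_le (min_le_right _ _))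
  refine ⟨1 - τ, by linarith, by linarith, norm_le _ fun r hr => ?_⟩
  have hsub : ((f - f.dilate (1 - τ) (by linarith) (by linarith) : WeightedB0 v p) : ℂ → ℂ) =
    (f : ℂ → ℂ) - fun z => f (((1 - τ : ℝ) : ℂ) * z) := rfl
  rw [hsub]
  rcases le_total r (2 * R) with h | h
  · have hvr : v (r : ℂ) ≤ v 0 := by
      simpa using v.antitone Set.self_mem_Ici hr.le hr.le
    have hm : integralMean p ((f : ℂ → ℂ) - fun z => f (((1 - τ : ℝ) : ℂ) * z)) r ≤ ε / v 0 := by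
      refine integralMean_le_of_bound hp.1 hr.le fun z hz => ?_
      have hnz : ‖((1 - τ : ℝ) : ℂ) * z‖ ≤ 2 * R := by
        rw [norm_mul, Complex.norm_real, Real.norm_of_nonneg (by linarith), hz]
        nlinarith
      have hd : dist z (((1 - τ : ℝ) : ℂ) * z) < δ := by
        have : z - ((1 - τ : ℝ) : ℂ) * z = (τ : ℂ) * z := by push_cast; ring
        rw [dist_eq_norm, this, norm_mul, Complex.norm_real, Real.norm_of_nonneg hτ0.le, hz]
        nlinarith
      have := huc z (by simpa [hz] using h) _ (by simpa using hnz) hd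
      rw [dist_eq_norm] at this
      exact this.le
    refine (mul_le_mul hvr hm (integralMean_nonneg _ _ _) hv0.le).trans (le_of_eq ?_)
    rw [mul_div_cancel₀ _ hv0.ne']
  · have hρ : (0 : ℝ) ≤ 1 - τ := by linarith
    have hcd : Continuous fun z => f (((1 - τ : ℝ) : ℂ) * z) :=
      f.continuous.comp (continuous_const.mul continuous_id)
    have h1 := le_integralMean_add (f.continuous.sub hcd) f.continuous hp.1 hr.le
    have h2 : (f : ℂ → ℂ) - (fun z => f (((1 - τ : ℝ) : ℂ) * z)) - f =
        0 - fun z => f (((1 - τ : ℝ) : ℂ) * z) := by abel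
    rw [h2, integralMean_sub_comm continuous_zero hcd hp.1 hr.le, sub_zero] at h1
    have h3 := h1.trans (add_le_add_right
      (integralMean_dilate_le f.continuous hp.1 hρ hr.le) _)
    have h4 := mul_le_mul_of_nonneg_left h3 (v.pos (r : ℂ)).le
    have h5 : v (r : ℂ) ≤ v (((1 - τ) * r : ℝ) : ℂ) :=
      v.antitone (Set.mem_Ici.2 (by positivity)) hr.le (by nlinarith)
    have h6 := mul_le_mul_of_nonneg_right h5 (integralMean_nonneg p f ((1 - τ) * r))
    have h7 := hR' r (by linarith)
    have h8 := hR' ((1 - τ) * r) (by nlinarith)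
    rw [mul_add] at h4
    linarith

lemma dense_span_monomial :
    Dense (Submodule.span ℂ (Set.range (monomial v p)) : Set (WeightedB0 v p)) := by
  intro f
  rw [← closure_closure, Metric.mem_closure_iff]
  intro ε hε
  obtain ⟨ρ, h0, h1, h⟩ := f.exists_norm_sub_dilate_le (half_pos hε)
  refine ⟨_, f.dilate_mem_closure h0 h1, ?_⟩
  rw [dist_eq_norm]
  linarith

/-! ### Separability and the generalized kernel of differentiation -/

instance : TopologicalSpace.SeparableSpace (WeightedB0 v p) := by
  rw [← TopologicalSpace.isSeparable_univ_iff,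
    ← (dense_span_monomial (v := v) (p := p)).closure_eq]
  exact (Set.countable_range _).isSeparable.span.closure

lemma dense_setOf_pow_apply_eq_zero {D : WeightedB0 v p →L[ℂ] WeightedB0 v p}
    (hD : ∀ (f : WeightedB0 v p) (z : ℂ), D f z = deriv f z) :
    Dense {f : WeightedB0 v p | ∃ N, (D ^ N) f = 0} := by
  have hmono : ∀ n, (D ^ (n + 1)) (monomial v p n) = 0 := by
    intro n
    induction n with
    | zero =>
      rw [zero_add, pow_one]
      ext z
      rw [hD]
      change deriv (fun z : ℂ => z ^ 0) z = 0
      simp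
    | succ n ih =>
      have : D (monomial v p (n + 1)) = ((n + 1 : ℕ) : ℂ) • monomial v p n := by
        ext z
        rw [hD]
        change deriv (fun z : ℂ => z ^ (n + 1)) z = ((n + 1 : ℕ) : ℂ) * z ^ n
        simp
      rw [pow_succ, mul_apply_eq_comp, this, map_smul, ih, smul_zero]
  refine dense_span_monomial.mono fun f hf => ?_
  induction hf using Submodule.span_induction with
  | mem x hx =>
    obtain ⟨n, rfl⟩ := hx
    exact ⟨n + 1, hmono n⟩
  | zero => exact ⟨0, map_zero _⟩
  | add x y _ _ hx hy =>
    obtain ⟨N, hN⟩ := hx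
    obtain ⟨N', hN'⟩ := hy
    refine ⟨max N N', ?_⟩
    rw [map_add, pow_apply_eq_zero_of_le hN (le_max_left _ _),
      pow_apply_eq_zero_of_le hN' (le_max_right _ _), add_zero]
  | smul c x _ hx =>
    obtain ⟨N, hN⟩ := hx
    exact ⟨N, by rw [map_smul, hN, smul_zero]⟩

/-! ### The exponential function as a fixed vector -/

lemma tendsto_mul_integralMean_exp (hv : Tendsto
    (fun r : ℝ => v (r : ℂ) * (Real.exp r / r ^ (1 / (2 * p)).toReal)) atTop (𝓝 0)) :
    Tendsto (fun r : ℝ => v (r : ℂ) * integralMean p Complex.exp r) atTop (𝓝 0) := by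
  obtain ⟨C, hC⟩ := integralMean_exp_le hp.1
  have h := hv.const_mul C
  rw [mul_zero] at h
  refine tendsto_of_tendsto_of_tendsto_of_le_of_le' tendsto_const_nhds h
    (Eventually.of_forall fun r => mul_nonneg (v.pos _).le (integralMean_nonneg _ _ _)) ?_
  filter_upwards [eventually_gt_atTop 0] with r hr
  refine (mul_le_mul_of_nonneg_left (hC r hr) (v.pos _).le).trans (le_of_eq ?_)
  ring

end WeightedB0

end

theorem mainTheorem5 (p : ℝ≥0∞) [Fact (1 ≤ p)] (v : RadialWeight)
    (hv : Tendsto (fun r : ℝ => v (r : ℂ) * (Real.exp r / r ^ (1 / (2 * p)).toReal))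
      atTop (𝓝 0))
    (D : WeightedB0 v p →L[ℂ] WeightedB0 v p)
    (hD : ∀ (f : WeightedB0 v p) (z : ℂ), D f z = deriv f z) :
    ∃ M : Submodule ℂ (WeightedB0 v p), Dense (M : Set (WeightedB0 v p)) ∧
      ∀ f ∈ M, f ≠ 0 → IsDistributionallyIrregular D f := by
  let e : WeightedB0 v p :=
    ⟨Complex.exp, Complex.differentiable_exp, WeightedB0.tendsto_mul_integralMean_exp hv⟩
  have he : e ≠ 0 := fun h => by
    have h0 : e 0 = (0 : WeightedB0 v p) 0 := by rw [h]
    exact Complex.exp_ne_zero 0 h0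
  have hDe : D e = e := by
    ext z
    rw [hD]
    change deriv Complex.exp z = Complex.exp z
    rw [Complex.deriv_exp]
  exact exists_dense_submodule_isDistributionallyIrregular he hDe
    (WeightedB0.dense_setOf_pow_apply_eq_zero hD)
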